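/- Let $K\in\{\mathbb R,\mathbb C\}$, let $n\ge 1$ and let $X=K^n$ with its Euclidean norm and scalar product $\langle x,y\rangle=\sum_k x_k\overline{y_k}$. Let $(T,d_T)$ be a compact metric space with at least two points, with Borel $\sigma$-algebra $\mathcal B$. Let $cabv(X)$ be the space of all $\sigma$-additive measures $\mu:\mathcal B\to X$ of finite total variation, with the norm $\|\mu\|=|\mu|(T)$, and let $B_a(X)=\{\mu\in cabv(X):\|\mu\|\le a\}$. For continuous $f:T\to X$ let $\int f\,d\mu\in K$ be the integral determined by $\int \varphi_A x\,d\mu=\langle x,\mu(A)\rangle$ ($A\in\mathcal B$, $x\in X$) through uniform limits of simple functions. A set $A\subseteq cabv(X)$ is called weak$^*$ closed if it is closed for the weak$^*$ topology obtained by identifying $cabv(X)$ with the dual of $C(T,X)$ through $\mu\mapsto(f\mapsto\int f\,d\mu)$, i.e. the coarsest topology making all the maps $\mu\mapsto\int f\,d\mu$, $f\in C(T,X)$, continuous. For a Lipschitz map $f$ on $T$ let $\|f\|_L$ be its Lipschitz constant, and put $d_{MK}(\mu,\nu)=\|\mu-\nu\|_{MK}$, where $\|\mu\|_{MK}=\sup\{|\int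 f\,d\mu| : f:T\to X \text{ Lipschitz},\ \|f\|_\infty+\|f\|_L\le 1\}$. Let $(\omega_i)_{i\ge1}$ be a sequence of Lipschitz maps $T\to T$ whose Lipschitz constants $r_i=\|\omega_i\|_L$ form a bounded sequence, and let $(R_i)_{i\ge1}$ be a sequence of linear operators on $X$ such that $\sum_{i\ge1}\|R_i\|<\infty$ (operator norms). Then, for every $\mu\in cabv(X)$, the series $$H(\mu)=\sum_{i\ge1}R_i\circ\omega_i(\mu),\qquad (R_i\circ\omega_i(\mu))(B)=R_i(\mu(\omega_i^{-1}(B))),$$ converges absolutely in $cabv(X)$, and the series $d=\sum_{i\ge1}\|R_i\|(1+r_i)$ converges. Moreover: (1) If all $\omega_i$ are contractions ($r_i<1$) and $\sum_i\|R_i\|\le\frac12$, then $d<1$. (2) If $0<a<\infty$, $\mu^0\in cabv(X)$ and $\|\mu^0\|+a\sum_i\|R_i\|\le a$, then $A=B_a(X)$ is non-empty, weak$^*$ closed, and $H(\mu)+\mu^0\in A$ for all $\mu\in A$. (3) Assume $d<1$. Let $0<a<\infty$, let $\mu^0\in cabv(X)$, and let $\emptyset\ne A\subseteq B_a(X)$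 be weak$^*$ closed with $H(\mu)+\mu^0\in A$ for all $\mu\in A$. Define $H_2:A\to A$ by $H_2(\mu)=H(\mu)+\mu^0$. Then $H_2$ is a contraction with contraction factor $\le d$ for the metric $d_{MK}$, i.e. $d_{MK}(H_2(\mu),H_2(\nu))\le d\cdot d_{MK}(\mu,\nu)$ for all $\mu,\nu\in A$; if $\mu^0=0$, then $0\in A$; and there is a unique $\mu^*\in A$ with $H_2(\mu^*)=\mu^*$. If $\mu^0=0$, then $\mu^*=0$. -/

import Mathlib

open MeasureTheory
open scoped ENNReal NNReal

noncomputable section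

namespace VectorMarkov

section Lipschitz

variable {T Y : Type*} [MetricSpace T] [MetricSpace Y]

/-- `f` is lipschitzian. -/
def IsLip (f : T → Y) : Prop := ∃ C : ℝ≥0, LipschitzWith C f

/-- The Lipschitz constant `‖f‖_L = sup {d(f x, f y) / d(x, y) : x ≠ y}` of a lipschitzian map. -/
def lipConst (f : T → Y) : ℝ :=
  sSup {q : ℝ | ∃ x y : T, x ≠ y ∧ q = dist (f x) (f y) / dist x y}

end Lipschitz

section BL

variable {T X : Type*} [MetricSpace T] [NormedAddCommGroup X]

/-- The norm `‖f‖_∞ = sup {‖f t‖ : t ∈ T}` of a bounded function. -/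
def supNorm (f : T → X) : ℝ := ⨆ t, ‖f t‖

/-- The norm `‖f‖_BL = ‖f‖_∞ + ‖f‖_L` of a lipschitzian function on a compact space. -/
def blNorm (f : T → X) : ℝ := supNorm f + lipConst f

variable (T X) in
/-- The closed unit ball `BL₁(X)` of the lipschitzian functions for `‖·‖_BL`. -/
def BL1 : Set (T → X) := {f | IsLip f ∧ blNorm f ≤ 1}

end BL

section cabv

variable (𝕜 : Type*) [RCLike 𝕜] (T : Type*) [MeasurableSpace T]
  (X : Type*) [NormedAddCommGroup X] [NormedSpace 𝕜 X]

/-- The space `cabv(X)` of the σ-additive `X`-valued measures on `T` of finite total variation. -/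
def cabv : Submodule 𝕜 (VectorMeasure T X) where
  carrier := {μ | μ.variation Set.univ < ∞}
  zero_mem' := by simp
  add_mem' := by
    intro μ ν hμ hν
    exact (Measure.le_iff'.1 VectorMeasure.variation_add_le Set.univ).trans_lt
      (ENNReal.add_lt_top.2 ⟨hμ, hν⟩)
  smul_mem' := by
    intro c μ hμ
    simp only [Set.mem_ofPred_eq, VectorMeasure.variation_smul, Measure.smul_apply,
      Measure.nnreal_smul_coe_apply] at hμ ⊢
    exact ENNReal.mul_lt_top ENNReal.coe_lt_top hμ

variable {𝕜 T X}

/-- The total variation `|μ|(T)` as a norm on `cabv(X)`. -/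
def variationNorm : AddGroupNorm (cabv 𝕜 T X) where
  toFun μ := ((μ : VectorMeasure T X).variation Set.univ).toReal
  map_zero' := by simp
  add_le' := by
    intro μ ν
    have hμ : (μ : VectorMeasure T X).variation Set.univ < ∞ := μ.2
    have hν : (ν : VectorMeasure T X).variation Set.univ < ∞ := ν.2
    rw [← ENNReal.toReal_add hμ.ne hν.ne]
    exact ENNReal.toReal_mono (ENNReal.add_lt_top.2 ⟨hμ, hν⟩).ne
      (Measure.le_iff'.1 VectorMeasure.variation_add_le Set.univ)
  neg' := by
    intro μ
    simp
  eq_zero_of_map_eq_zero' := by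
    intro μ h
    have hμ : (μ : VectorMeasure T X).variation Set.univ < ∞ := μ.2
    have h0 : (μ : VectorMeasure T X).variation Set.univ = 0 :=
      ((ENNReal.toReal_eq_zero_iff _).1 h).resolve_right hμ.ne
    exact Subtype.ext (VectorMeasure.variation_eq_zero.1 (Measure.measure_univ_eq_zero.1 h0))

/-- `cabv(X)` is normed by the total variation. -/
instance : NormedAddCommGroup (cabv 𝕜 T X) := variationNorm.toNormedAddCommGroup

variable (𝕜 T X) in
/-- `B_a(X)`: the measures of total variation at most `a`. -/
def cabvBall (a : ℝ) : Set (cabv 𝕜 T X) := {μ | ‖μ‖ ≤ a}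

/-- The measure `R ∘ ω(μ)`, i.e. `B ↦ R (μ (ω⁻¹ B))`. -/
def pushforward (R : X →L[𝕜] X) (ω : T → T) (μ : cabv 𝕜 T X) : cabv 𝕜 T X :=
  ⟨((μ : VectorMeasure T X).map ω).mapRange R.toLinearMap.toAddMonoidHom R.continuous, by
    have hμ : (μ : VectorMeasure T X).variation Set.univ < ∞ := μ.2
    have hμ' : IsFiniteMeasure (μ : VectorMeasure T X).variation := ⟨hμ⟩
    have h : (((μ : VectorMeasure T X).map ω).mapRange R.toLinearMap.toAddMonoidHom
        R.continuous).variation ≤ ‖R‖₊ • ((μ : VectorMeasure T X).map ω).variation := by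
      refine VectorMeasure.variation_le_of_forall_enorm_le fun E _ => ?_
      calc ‖R (((μ : VectorMeasure T X).map ω) E)‖ₑ
          ≤ ‖R‖ₑ * ‖((μ : VectorMeasure T X).map ω) E‖ₑ := R.le_opENorm _
        _ ≤ ‖R‖ₑ * ((μ : VectorMeasure T X).map ω).variation E := by
          gcongr
          exact VectorMeasure.enorm_measure_le_variation _ E
        _ = (‖R‖₊ • ((μ : VectorMeasure T X).map ω).variation) E := by
          simp [enorm_eq_nnnorm]
    exact (Measure.le_iff'.1 h Set.univ).trans_lt (measure_lt_top _ _)⟩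

/-- The Markov-type operator `H(μ) = ∑ᵢ Rᵢ ∘ ωᵢ(μ)`, the series being taken in `cabv(X)` with the
total variation norm. -/
def markovOp (R : ℕ → X →L[𝕜] X) (ω : ℕ → T → T) (μ : cabv 𝕜 T X) : cabv 𝕜 T X :=
  ∑' i, pushforward (R i) (ω i) μ

end cabv

section pairing

variable {𝕜 : Type*} [RCLike 𝕜] {T : Type*} [MeasurableSpace T]
  {X : Type*} [NormedAddCommGroup X] [InnerProductSpace 𝕜 X] [NormedSpace ℝ X]
  [IsScalarTower ℝ 𝕜 X]

variable (𝕜 X) in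
/-- The scalar product of `X`, linear in the first and antilinear in the second variable, as a
continuous real-bilinear map: `(x, y) ↦ ⟨x, y⟩`, which is `inner 𝕜 y x` in Mathlib's convention. -/
def scalarProd : X →L[ℝ] X →L[ℝ] 𝕜 :=
  (isBoundedBilinearMap_inner (𝕜 := 𝕜) (E := X)).toContinuousLinearMap.flip

/-- The scalar-valued integral `∫ f dμ` determined by `∫ φ_A x dμ = ⟨x, μ(A)⟩`; it is linear in `f`
and antilinear in `μ`. -/
def vIntegral (f : T → X) (μ : cabv 𝕜 T X) : 𝕜 :=
  (μ : VectorMeasure T X).integral f (scalarProd 𝕜 X)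

/-- The Monge–Kantorovich norm `‖μ‖_MK = sup {|∫ f dμ| : f ∈ BL₁(X)}`. -/
def mkNorm [MetricSpace T] (μ : cabv 𝕜 T X) : ℝ :=
  sSup {q : ℝ | ∃ f ∈ BL1 T X, q = ‖vIntegral f μ‖}

/-- The Monge–Kantorovich distance `d_MK(μ, ν) = ‖μ - ν‖_MK`. -/
def mkDist [MetricSpace T] (μ ν : cabv 𝕜 T X) : ℝ := mkNorm (μ - ν)

/-- `A` is weak* closed in `cabv(X) ≡ C(T, X)'`, where `μ` is identified with the functional
`f ↦ ∫ f dμ`: it is closed for the coarsest topology on `cabv(X)` for which all the maps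
`μ ↦ ∫ f dμ` with `f : T → X` continuous are continuous. -/
def IsWeakStarClosed [TopologicalSpace T] (A : Set (cabv 𝕜 T X)) : Prop :=
  @IsClosed (cabv 𝕜 T X)
    (TopologicalSpace.induced (fun μ (f : C(T, X)) => vIntegral (⇑f) μ) Pi.topologicalSpace) A

end pairing

end VectorMarkov

end

/-! Weak* compactness and the topology of `mkDist` are not needed for the fixed point. Since `1 + rᵢ
≥ 1`, the hypothesis `d < 1` forces `∑ ‖Rᵢ‖ < 1`, so `μ ↦ H(μ) + μ₀` already contracts the total
variation norm (`contractingWith_markovOp_add`). That norm is complete (`completeSpace_cabv`), and a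
weak* closed set is norm closed (`IsWeakStarClosed.isClosed`), so Banach's theorem applies on `A`.
Uniqueness holds on all of `cabv(X)`; for `μ₀ = 0` the fixed point is therefore `0`, which puts `0`
in `A`.

The estimate for `d_MK` is separate and rests on the duality `∫ f d(R ∘ ω(μ)) = ∫ R* (f ∘ ω) dμ`
(`vIntegral_pushforward`): passing from `f` to `R* (f ∘ ω)` multiplies the sup norm by at most `‖R‖`
and the Lipschitz constant by at most `‖R‖ r`.

The ball is weak* closed because the total variation is the supremum of `|∫ f dμ|` over continuous
`f` with values in the unit ball (`norm_le_of_forall_vIntegral_le`). -/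

open Filter Topology

namespace VectorMarkov

/-! ### Completeness of `cabv(X)` for the total variation. -/

section Complete

variable {𝕜 : Type*} [RCLike 𝕜] {T : Type*} [MeasurableSpace T]
  {X : Type*} [NormedAddCommGroup X] [NormedSpace 𝕜 X]

instance isFiniteMeasure_variation (μ : cabv 𝕜 T X) :
    IsFiniteMeasure (μ : VectorMeasure T X).variation := ⟨μ.2⟩

lemma norm_cabv (μ : cabv 𝕜 T X) :
    ‖μ‖ = (μ : VectorMeasure T X).variation.real Set.univ := rfl

lemma enorm_cabv (μ : cabv 𝕜 T X) :
    ‖μ‖ₑ = (μ : VectorMeasure T X).variation Set.univ := by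
  rw [← ofReal_norm, norm_cabv, ofReal_measureReal]

lemma norm_apply_le (μ : cabv 𝕜 T X) (B : Set T) : ‖(μ : VectorMeasure T X) B‖ ≤ ‖μ‖ :=
  (VectorMeasure.norm_measure_le_variation (measure_ne_top _ _)).trans
    (measureReal_mono (Set.subset_univ B))

lemma norm_le_of_variation_le {μ : cabv 𝕜 T X} {m : Measure T} {C : ℝ} (hC : 0 ≤ C)
    (h : (μ : VectorMeasure T X).variation ≤ m) (hm : m Set.univ ≤ ENNReal.ofReal C) : ‖μ‖ ≤ C := by
  rw [norm_cabv, measureReal_def]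
  exact ENNReal.toReal_le_of_le_ofReal hC ((Measure.le_iff'.1 h Set.univ).trans hm)

lemma coe_finsetSum_apply {ι : Type*} (s : Finset ι) (u : ι → cabv 𝕜 T X) (B : Set T) :
    ((∑ i ∈ s, u i : cabv 𝕜 T X) : VectorMeasure T X) B
      = ∑ i ∈ s, (u i : VectorMeasure T X) B := by
  classical
  induction s using Finset.induction_on with
  | empty => simp
  | insert a s ha ih => simp [Finset.sum_insert ha]

/-- The setwise sum of an absolutely convergent series in `cabv(X)`. -/
noncomputable def setwiseSum [CompleteSpace X] (u : ℕ → cabv 𝕜 T X) (hu : Summable fun i => ‖u i‖) :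
    VectorMeasure T X where
  measureOf' B := ∑' i, (u i : VectorMeasure T X) B
  empty' := by simp
  not_measurable' B hB := by simp [VectorMeasure.not_measurable _ hB]
  m_iUnion' f hf hd := by
    have hs (B : Set T) : Summable fun i => (u i : VectorMeasure T X) B :=
      Summable.of_norm_bounded hu fun i => norm_apply_le (u i) B
    have hfin (s : Finset ℕ) : ∑ n ∈ s, ∑' i, (u i : VectorMeasure T X) (f n)
        = ∑' i, (u i : VectorMeasure T X) (⋃ n ∈ s, f n) := by
      rw [← Summable.tsum_finsetSum fun n _ => hs (f n)]
      congr 1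
      ext i : 1
      exact (VectorMeasure.of_biUnion_finset (fun a _ b _ hab => hd hab) fun b _ => hf b).symm
    unfold HasSum
    simp_rw [hfin]
    -- Countable additivity passes through the series by dominated convergence, with the bound `‖u
    -- i‖` independent of the set.
    refine tendsto_tsum_of_dominated_convergence hu (fun i => ?_)
      (Eventually.of_forall fun s i => norm_apply_le (u i) _)
    have h := VectorMeasure.hasSum_of_disjoint_iUnion (v := (u i : VectorMeasure T X)) hf hd
    refine h.congr fun s => ?_
    exact (VectorMeasure.of_biUnion_finset (fun a _ b _ hab => hd hab) fun b _ => hf b).symm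

lemma variation_setwiseSum_le [CompleteSpace X] (u : ℕ → cabv 𝕜 T X) (hu : Summable fun i => ‖u i‖) :
    (setwiseSum u hu).variation ≤ Measure.sum fun i => (u i : VectorMeasure T X).variation := by
  refine VectorMeasure.variation_le_of_forall_enorm_le fun B hB => ?_
  rw [Measure.sum_apply _ hB]
  exact enorm_tsum_le_tsum_enorm.trans
    (ENNReal.tsum_le_tsum fun i => VectorMeasure.enorm_measure_le_variation _ B)

lemma sum_variation_univ (u : ℕ → cabv 𝕜 T X) (hu : Summable fun i => ‖u i‖) :
    (Measure.sum fun i => (u i : VectorMeasure T X).variation) Set.univ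
      = ENNReal.ofReal (∑' i, ‖u i‖) := by
  rw [Measure.sum_apply _ MeasurableSet.univ,
    ENNReal.ofReal_tsum_of_nonneg (fun _ => norm_nonneg _) hu]
  simp_rw [ofReal_norm, enorm_cabv]

/-- It suffices to sum absolutely convergent series. The remainder after `N` terms is the setwise
sum of the shifted series, so its variation is at most the tail of `∑ ‖u i‖`. -/
instance completeSpace_cabv [CompleteSpace X] : CompleteSpace (cabv 𝕜 T X) := by
  refine NormedAddCommGroup.completeSpace_of_summable_imp_tendsto fun u hu => ?_
  have hmem : setwiseSum u hu ∈ cabv 𝕜 T X :=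
    ((Measure.le_iff'.1 (variation_setwiseSum_le u hu) Set.univ).trans
      (sum_variation_univ u hu).le).trans_lt ENNReal.ofReal_lt_top
  refine ⟨⟨setwiseSum u hu, hmem⟩, ?_⟩
  rw [tendsto_iff_norm_sub_tendsto_zero]
  refine squeeze_zero (fun _ => norm_nonneg _) (fun N => ?_)
    (tendsto_sum_nat_add fun i => ‖u i‖)
  have hu' : Summable fun i => ‖u (i + N)‖ := (summable_nat_add_iff N).2 hu
  rw [norm_sub_rev]
  refine norm_le_of_variation_le (tsum_nonneg fun _ => norm_nonneg _) ?_
    (sum_variation_univ (fun i => u (i + N)) hu').le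
  have heq : (((⟨setwiseSum u hu, hmem⟩ : cabv 𝕜 T X) - ∑ i ∈ Finset.range N, u i :
      cabv 𝕜 T X) : VectorMeasure T X) = setwiseSum (fun i => u (i + N)) hu' := by
    ext B _
    have hs : Summable fun i => (u i : VectorMeasure T X) B :=
      Summable.of_norm_bounded hu fun i => norm_apply_le (u i) B
    rw [Submodule.coe_sub, sub_apply, coe_finsetSum_apply]
    exact sub_eq_of_eq_add' (hs.sum_add_tsum_nat_add N).symm
  rw [heq]
  exact variation_setwiseSum_le _ hu'

end Complete

/-! ### Norm bounds and additivity of `H`. -/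

section Operator

variable {𝕜 : Type*} [RCLike 𝕜] {T : Type*} [MeasurableSpace T]
  {X : Type*} [NormedAddCommGroup X] [NormedSpace 𝕜 X]

lemma pushforward_apply (R : X →L[𝕜] X) {ω : T → T} (hω : Measurable ω) (μ : cabv 𝕜 T X)
    {B : Set T} (hB : MeasurableSet B) :
    (pushforward R ω μ : VectorMeasure T X) B = R ((μ : VectorMeasure T X) (ω ⁻¹' B)) := by
  change R (((μ : VectorMeasure T X).map ω) B) = _
  rw [VectorMeasure.map_apply _ hω hB]

lemma variation_pushforward_le (R : X →L[𝕜] X) (ω : T → T) (μ : cabv 𝕜 T X) :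
    (pushforward R ω μ : VectorMeasure T X).variation
      ≤ ‖R‖₊ • ((μ : VectorMeasure T X).map ω).variation := by
  refine VectorMeasure.variation_le_of_forall_enorm_le fun E _ => ?_
  calc ‖R (((μ : VectorMeasure T X).map ω) E)‖ₑ
      ≤ ‖R‖ₑ * ‖((μ : VectorMeasure T X).map ω) E‖ₑ := R.le_opENorm _
    _ ≤ ‖R‖ₑ * ((μ : VectorMeasure T X).map ω).variation E := by
      gcongr
      exact VectorMeasure.enorm_measure_le_variation _ E
    _ = (‖R‖₊ • ((μ : VectorMeasure T X).map ω).variation) E := by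
      simp [enorm_eq_nnnorm]

lemma norm_pushforward_le (R : X →L[𝕜] X) {ω : T → T} (hω : Measurable ω) (μ : cabv 𝕜 T X) :
    ‖pushforward R ω μ‖ ≤ ‖R‖ * ‖μ‖ := by
  refine norm_le_of_variation_le (by positivity) (variation_pushforward_le R ω μ) ?_
  rw [ENNReal.ofReal_mul (norm_nonneg _), ofReal_norm, ofReal_norm, enorm_cabv, enorm_eq_nnnorm]
  change (‖R‖₊ : ℝ≥0∞) * ((μ : VectorMeasure T X).map ω).variation Set.univ ≤ _
  refine mul_le_mul' le_rfl ?_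
  refine (Measure.le_iff'.1 (VectorMeasure.variation_map_le
    (μ := (μ : VectorMeasure T X)) (φ := ω)) Set.univ).trans ?_
  rw [Measure.map_apply hω MeasurableSet.univ, Set.preimage_univ]

lemma pushforward_sub (R : X →L[𝕜] X) {ω : T → T} (hω : Measurable ω) (μ ν : cabv 𝕜 T X) :
    pushforward R ω (μ - ν) = pushforward R ω μ - pushforward R ω ν := by
  refine Subtype.ext (VectorMeasure.ext fun B hB => ?_)
  rw [Submodule.coe_sub, sub_apply]
  simp only [pushforward_apply R hω _ hB]
  simp

variable {R : ℕ → X →L[𝕜] X} {ω : ℕ → T → T}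

lemma summable_norm_pushforward (hω : ∀ i, Measurable (ω i)) (hR : Summable fun i => ‖R i‖)
    (μ : cabv 𝕜 T X) : Summable fun i => ‖pushforward (R i) (ω i) μ‖ :=
  Summable.of_nonneg_of_le (fun _ => norm_nonneg _)
    (fun i => norm_pushforward_le (R i) (hω i) μ) (hR.mul_right ‖μ‖)

lemma hasSum_markovOp [CompleteSpace X] (hω : ∀ i, Measurable (ω i)) (hR : Summable fun i => ‖R i‖)
    (μ : cabv 𝕜 T X) :
    HasSum (fun i => pushforward (R i) (ω i) μ) (markovOp R ω μ) :=
  (summable_norm_pushforward hω hR μ).of_norm.hasSum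

lemma norm_markovOp_le (hω : ∀ i, Measurable (ω i)) (hR : Summable fun i => ‖R i‖)
    (μ : cabv 𝕜 T X) : ‖markovOp R ω μ‖ ≤ (∑' i, ‖R i‖) * ‖μ‖ :=
  tsum_of_norm_bounded (hR.hasSum.mul_right ‖μ‖) fun i => norm_pushforward_le (R i) (hω i) μ

lemma markovOp_sub [CompleteSpace X] (hω : ∀ i, Measurable (ω i)) (hR : Summable fun i => ‖R i‖)
    (μ ν : cabv 𝕜 T X) : markovOp R ω (μ - ν) = markovOp R ω μ - markovOp R ω ν := by
  refine (hasSum_markovOp hω hR (μ - ν)).unique ?_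
  simp_rw [pushforward_sub _ (hω _)]
  exact (hasSum_markovOp hω hR μ).sub (hasSum_markovOp hω hR ν)

end Operator

/-! ### The scalar integral and its transposition under `R ∘ ω`. -/

section Integral

variable {𝕜 : Type*} [RCLike 𝕜] {T : Type*} [MeasurableSpace T]
  {X : Type*} [NormedAddCommGroup X] [InnerProductSpace 𝕜 X] [NormedSpace ℝ X]
  [IsScalarTower ℝ 𝕜 X]

@[simp]
lemma scalarProd_apply (x y : X) : scalarProd 𝕜 X x y = inner 𝕜 y x := rfl

lemma norm_scalarProd_le : ‖scalarProd 𝕜 X‖ ≤ 1 :=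
  ContinuousLinearMap.opNorm_le_bound₂ _ zero_le_one fun x y => by
    rw [scalarProd_apply, one_mul, mul_comm]
    exact norm_inner_le_norm y x

lemma norm_vIntegral_le_integral (f : T → X) (μ : cabv 𝕜 T X) :
    ‖vIntegral f μ‖ ≤ ∫ t, ‖f t‖ ∂(μ : VectorMeasure T X).variation :=
  VectorMeasure.norm_integral_le_integral_norm.trans <|
    mul_le_of_le_one_left (integral_nonneg fun _ => norm_nonneg _) norm_scalarProd_le

lemma norm_vIntegral_le {f : T → X} {C : ℝ} (hf : ∀ t, ‖f t‖ ≤ C) (hC : 0 ≤ C)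
    (μ : cabv 𝕜 T X) : ‖vIntegral f μ‖ ≤ C * ‖μ‖ := by
  refine (VectorMeasure.norm_integral_le_of_norm_le_const (ae_of_all _ hf)).trans ?_
  rw [norm_cabv]
  gcongr
  exact mul_le_of_le_one_right hC norm_scalarProd_le

lemma vIntegral_indicator_const {E : Set T} (hE : MeasurableSet E) (x : X) (μ : cabv 𝕜 T X) :
    vIntegral (E.indicator fun _ => x) μ = inner 𝕜 ((μ : VectorMeasure T X) E) x :=
  setToFun_indicator_const _ hE (measure_ne_top _ _) x

/-- A continuous linear map can be moved from the pairing to the integrand. -/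
lemma integral_comp_continuousLinearMap {E E' F G : Type*}
    [NormedAddCommGroup E] [NormedSpace ℝ E] [NormedAddCommGroup E'] [NormedSpace ℝ E']
    [NormedAddCommGroup F] [NormedSpace ℝ F] [NormedAddCommGroup G] [NormedSpace ℝ G]
    [CompleteSpace G] {μ : VectorMeasure T F}
    (B : E' →L[ℝ] F →L[ℝ] G) (L : E →L[ℝ] E') {g : T → E} (hg : Integrable g μ.variation) :
    μ.integral g (B.comp L) = μ.integral (fun t => L (g t)) B := by
  refine hg.induction (P := fun g => μ.integral g (B.comp L) = μ.integral (fun t => L (g t)) B)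
    (fun c s hs hμs => ?_) (fun f g _ hf hg hPf hPg => ?_) ?_ (fun f g hfg hf hP => ?_)
  · have : (fun t => L (s.indicator (fun _ => c) t)) = s.indicator fun _ => L c := by
      ext t
      by_cases ht : t ∈ s <;> simp [ht]
    rw [this]
    have h := setToFun_indicator_const
      (dominatedFinMeasAdditive_cbmApplyMeasure μ B) hs hμs.ne (L c)
    exact (setToFun_indicator_const _ hs hμs.ne c).trans h.symm
  · simp only [Pi.add_apply, map_add]
    rw [show f + g = fun t => f t + g t from rfl, VectorMeasure.integral_fun_add hf hg,
      VectorMeasure.integral_fun_add (L.integrable_comp hf) (L.integrable_comp hg), hPf, hPg]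
  -- Both sides are continuous in `g` for the `L¹` norm, so the identity extends from simple
  -- functions by density.
  · refine isClosed_eq VectorMeasure.continuous_integral ?_
    have h := (VectorMeasure.continuous_integral (μ := μ) (B := B)).comp
      (L.compLpL 1 μ.variation).continuous
    refine h.congr fun f => ?_
    exact VectorMeasure.integral_congr_ae (L.coeFn_compLpL f)
  · rw [← VectorMeasure.integral_congr_ae hfg, hP]
    exact VectorMeasure.integral_congr_ae (hfg.fun_comp L)

section Topological

variable [TopologicalSpace T] [CompactSpace T] [OpensMeasurableSpace T]
  [SecondCountableTopology T]

omit [NormedSpace ℝ X] in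
lemma integrable_of_continuous {f : T → X} (hf : Continuous f) (m : Measure T)
    [IsFiniteMeasure m] : Integrable f m := by
  obtain ⟨C, hC⟩ := isCompact_univ.exists_bound_of_continuousOn hf.continuousOn
  exact Integrable.of_bound hf.aestronglyMeasurable C (ae_of_all _ fun t => hC t trivial)

/-- The integral of a fixed continuous function, as an additive map on `cabv(X)`. -/
noncomputable def vIntegralHom {f : T → X} (hf : Continuous f) : cabv 𝕜 T X →+ 𝕜 where
  toFun μ := vIntegral f μ
  map_zero' := VectorMeasure.integral_zero_vectorMeasure
  map_add' _ _ := VectorMeasure.integral_add_vectorMeasure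
    (integrable_of_continuous hf _) (integrable_of_continuous hf _)

lemma continuous_vIntegral {f : T → X} (hf : Continuous f) :
    Continuous fun μ : cabv 𝕜 T X => vIntegral f μ := by
  obtain ⟨C, hC⟩ := isCompact_univ.exists_bound_of_continuousOn hf.continuousOn
  refine AddMonoidHomClass.continuous_of_bound (vIntegralHom (𝕜 := 𝕜) hf) (max C 0) fun μ => ?_
  exact norm_vIntegral_le (fun t => (hC t trivial).trans (le_max_left _ _)) (le_max_right _ _) μ

/-- Each functional `μ ↦ ∫ f dμ` is norm continuous, so the norm topology is finer than the weak*
one. -/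
lemma IsWeakStarClosed.isClosed {A : Set (cabv 𝕜 T X)} (hA : IsWeakStarClosed A) :
    IsClosed A := by
  obtain ⟨S, hS, rfl⟩ := isClosed_induced_iff.1 hA
  exact hS.preimage (continuous_pi fun f => continuous_vIntegral f.continuous)

/-- On sets this is `⟨x, R y⟩ = ⟨R* x, y⟩`: applying `R` to the measure amounts to composing the
pairing with `R*`. Change of variables along `ω` then leaves `R*` to be moved into the integrand. -/
lemma vIntegral_pushforward [CompleteSpace X] (R : X →L[𝕜] X) {ω : T → T} (hω : Continuous ω)
    [BorelSpace T] {f : T → X} (hf : Continuous f) (μ : cabv 𝕜 T X) :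
    vIntegral f (pushforward R ω μ) = vIntegral (fun t => R.adjoint (f (ω t))) μ := by
  have hT : ⇑((pushforward R ω μ : VectorMeasure T X).transpose (scalarProd 𝕜 X)) =
      ⇑(((μ : VectorMeasure T X).map ω).transpose
        ((scalarProd 𝕜 X).comp (R.adjoint.restrictScalars ℝ))) := by
    ext B x
    exact (R.adjoint_inner_right _ x).symm
  have hdom : DominatedFinMeasAdditive ((μ : VectorMeasure T X).map ω).variation
      ((pushforward R ω μ : VectorMeasure T X).transpose (scalarProd 𝕜 X))
      ‖(scalarProd 𝕜 X).comp (R.adjoint.restrictScalars ℝ)‖ := by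
    rw [hT]
    exact dominatedFinMeasAdditive_cbmApplyMeasure _ _
  have hmap : vIntegral f (pushforward R ω μ) = ((μ : VectorMeasure T X).map ω).integral f
      ((scalarProd 𝕜 X).comp (R.adjoint.restrictScalars ℝ)) :=
    -- The two integrals are built over different variations; the domination by `‖R‖` times the
    -- variation of the image measure makes them agree.
    (setToFun_congr_measure_of_integrable (‖R‖₊ : ℝ≥0∞) ENNReal.coe_ne_top
      (variation_pushforward_le R ω μ) hdom _ f (integrable_of_continuous hf _)).symm.trans
      (setToFun_congr_left _ _ hT f)
  rw [hmap, VectorMeasure.integral_map hω.measurable hf.aestronglyMeasurable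
    (integrable_of_continuous (hf.comp hω) _)]
  exact integral_comp_continuousLinearMap _ _ (integrable_of_continuous (hf.comp hω) _)

end Topological

end Integral

/-! ### Lipschitz constants and the BL norm. -/

section Lipschitz

variable {T Y : Type*} [MetricSpace T] [MetricSpace Y]

lemma lipConst_nonneg (f : T → Y) : 0 ≤ lipConst f := by
  refine Real.sSup_nonneg ?_
  rintro _ ⟨x, y, _, rfl⟩
  positivity

lemma IsLip.continuous {f : T → Y} (hf : IsLip f) : Continuous f :=
  hf.choose_spec.continuous

lemma IsLip.dist_le {f : T → Y} (hf : IsLip f) (x y : T) :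
    dist (f x) (f y) ≤ lipConst f * dist x y := by
  rcases eq_or_ne x y with rfl | hxy
  · simp
  obtain ⟨C, hC⟩ := hf
  rw [← div_le_iff₀ (dist_pos.2 hxy)]
  refine le_csSup ⟨C, ?_⟩ ⟨x, y, hxy, rfl⟩
  rintro _ ⟨u, v, huv, rfl⟩
  exact (div_le_iff₀ (dist_pos.2 huv)).2 (hC.dist_le_mul u v)

lemma lipConst_le {f : T → Y} {K : ℝ} (hK : 0 ≤ K)
    (h : ∀ x y, dist (f x) (f y) ≤ K * dist x y) : lipConst f ≤ K := by
  refine Real.sSup_le ?_ hK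
  rintro _ ⟨x, y, hxy, rfl⟩
  exact (div_le_iff₀ (dist_pos.2 hxy)).2 (h x y)

lemma isLip_of_dist_le {f : T → Y} {K : ℝ} (hK : 0 ≤ K)
    (h : ∀ x y, dist (f x) (f y) ≤ K * dist x y) : IsLip f :=
  ⟨⟨K, hK⟩, LipschitzWith.of_dist_le_mul h⟩

end Lipschitz

section BL

variable {T X : Type*} [MetricSpace T] [NormedAddCommGroup X]

omit [MetricSpace T] in
lemma supNorm_nonneg (f : T → X) : 0 ≤ supNorm f := Real.iSup_nonneg fun _ => norm_nonneg _

lemma supNorm_le_blNorm (f : T → X) : supNorm f ≤ blNorm f :=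
  le_add_of_nonneg_right (lipConst_nonneg f)

omit [MetricSpace T] in
lemma supNorm_le {f : T → X} {K : ℝ} (hK : 0 ≤ K) (h : ∀ t, ‖f t‖ ≤ K) : supNorm f ≤ K :=
  Real.iSup_le h hK

lemma norm_le_supNorm [CompactSpace T] {f : T → X} (hf : Continuous f) (t : T) :
    ‖f t‖ ≤ supNorm f :=
  le_ciSup (isCompact_range hf.norm).bddAbove t

lemma zero_mem_BL1 : (0 : T → X) ∈ BL1 T X := by
  refine ⟨⟨0, LipschitzWith.const 0⟩, ?_⟩
  have h₁ : supNorm (0 : T → X) ≤ 0 := supNorm_le le_rfl (by simp)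
  have h₂ : lipConst (0 : T → X) ≤ 0 := lipConst_le le_rfl (by simp)
  unfold blNorm
  linarith

end BL

/-! ### The Monge–Kantorovich estimate. -/

section MK

variable {𝕜 : Type*} [RCLike 𝕜] {T : Type*} [MetricSpace T] [CompactSpace T] [MeasurableSpace T]
  {X : Type*} [NormedAddCommGroup X] [InnerProductSpace 𝕜 X] [NormedSpace ℝ X]
  [IsScalarTower ℝ 𝕜 X]

lemma bddAbove_mkNorm (μ : cabv 𝕜 T X) :
    BddAbove {q : ℝ | ∃ f ∈ BL1 T X, q = ‖vIntegral f μ‖} := by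
  refine ⟨‖μ‖, ?_⟩
  rintro _ ⟨f, hf, rfl⟩
  rw [← one_mul ‖μ‖]
  exact norm_vIntegral_le (fun t => (norm_le_supNorm hf.1.continuous t).trans
    ((supNorm_le_blNorm f).trans hf.2)) zero_le_one μ

lemma norm_vIntegral_le_mkNorm {f : T → X} (hf : f ∈ BL1 T X) (μ : cabv 𝕜 T X) :
    ‖vIntegral f μ‖ ≤ mkNorm μ :=
  le_csSup (bddAbove_mkNorm μ) ⟨f, hf, rfl⟩

lemma mkNorm_nonneg (μ : cabv 𝕜 T X) : 0 ≤ mkNorm μ :=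
  (norm_nonneg _).trans (norm_vIntegral_le_mkNorm zero_mem_BL1 μ)

omit [CompactSpace T] in
lemma mkNorm_le {μ : cabv 𝕜 T X} {C : ℝ} (h : ∀ f ∈ BL1 T X, ‖vIntegral f μ‖ ≤ C) :
    mkNorm μ ≤ C := by
  refine csSup_le ⟨_, 0, zero_mem_BL1, rfl⟩ ?_
  rintro _ ⟨f, hf, rfl⟩
  exact h f hf

omit [MetricSpace T] [CompactSpace T] in
lemma norm_vIntegral_smul (c : ℝ) (f : T → X) (μ : cabv 𝕜 T X) :
    ‖vIntegral (c • f) μ‖ = |c| * ‖vIntegral f μ‖ := by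
  have h := VectorMeasure.integral_smul f (μ : VectorMeasure T X) (scalarProd 𝕜 X) c
  exact (congrArg norm h).trans (norm_smul c _)

/-- By homogeneity: `(a + b)⁻¹ • f` lies in `BL1`. If `a + b = 0`, then `f = 0`. -/
lemma norm_vIntegral_le_of_bounds {f : T → X} {a b : ℝ} (ha : 0 ≤ a) (hb : 0 ≤ b)
    (hfa : ∀ t, ‖f t‖ ≤ a) (hfb : ∀ x y, dist (f x) (f y) ≤ b * dist x y) (μ : cabv 𝕜 T X) :
    ‖vIntegral f μ‖ ≤ (a + b) * mkNorm μ := by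
  rcases (add_nonneg ha hb).eq_or_lt with h0 | hpos
  · have ha0 : a = 0 := by linarith
    rw [← h0, zero_mul]
    simpa using norm_vIntegral_le (C := 0) (fun t => ha0 ▸ hfa t) le_rfl μ
  have hc : 0 < (a + b)⁻¹ := inv_pos.2 hpos
  have h₁ (t : T) : ‖((a + b)⁻¹ • f) t‖ ≤ (a + b)⁻¹ * a := by
    rw [Pi.smul_apply, norm_smul, Real.norm_of_nonneg hc.le]
    gcongr
    exact hfa t
  have h₂ (x y : T) : dist (((a + b)⁻¹ • f) x) (((a + b)⁻¹ • f) y)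
      ≤ (a + b)⁻¹ * b * dist x y := by
    rw [Pi.smul_apply, Pi.smul_apply, dist_smul₀, Real.norm_of_nonneg hc.le, mul_assoc]
    gcongr
    exact hfb x y
  have hmem : (a + b)⁻¹ • f ∈ BL1 T X := by
    refine ⟨isLip_of_dist_le (by positivity) h₂, ?_⟩
    have h₃ := supNorm_le (by positivity) h₁
    have h₄ := lipConst_le (by positivity) h₂
    have h₅ : (a + b)⁻¹ * a + (a + b)⁻¹ * b = 1 := by
      rw [← mul_add, inv_mul_cancel₀ hpos.ne']
    unfold blNorm
    linarith
  have h := norm_vIntegral_le_mkNorm hmem μ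
  rw [norm_vIntegral_smul, abs_of_pos hc] at h
  rwa [← inv_mul_le_iff₀ hpos]

variable [BorelSpace T] [CompleteSpace X]

lemma norm_vIntegral_pushforward_le (R : X →L[𝕜] X) {ω : T → T} (hω : IsLip ω) {f : T → X}
    (hf : f ∈ BL1 T X) (μ : cabv 𝕜 T X) :
    ‖vIntegral f (pushforward R ω μ)‖ ≤ ‖R‖ * (1 + lipConst ω) * mkNorm μ := by
  rw [vIntegral_pushforward R hω.continuous hf.1.continuous]
  have hr := lipConst_nonneg ω
  have hs := supNorm_nonneg f
  have hl := lipConst_nonneg f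
  have hbl : supNorm f + lipConst f ≤ 1 := hf.2
  have hR : ‖R.adjoint‖ = ‖R‖ := LinearIsometryEquiv.norm_map _ R
  refine (norm_vIntegral_le_of_bounds (a := ‖R‖ * supNorm f)
    (b := ‖R‖ * (lipConst f * lipConst ω)) (by positivity) (by positivity)
    (fun t => ?_) (fun x y => ?_) μ).trans ?_
  · refine (R.adjoint.le_opNorm _).trans ?_
    rw [hR]
    gcongr
    exact norm_le_supNorm hf.1.continuous _
  · rw [dist_eq_norm, ← map_sub]
    refine (R.adjoint.le_opNorm _).trans ?_
    rw [hR, ← dist_eq_norm, mul_assoc, mul_assoc]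
    gcongr
    refine (hf.1.dist_le _ _).trans ?_
    gcongr
    exact hω.dist_le x y
  -- Both `‖f‖_∞` and `‖f‖_L` are at most `1`, so `‖f‖_∞ + ‖f‖_L r ≤ 1 + r`.
  · rw [← mul_add]
    gcongr
    · exact mkNorm_nonneg μ
    · linarith
    · exact mul_le_of_le_one_left hr (by linarith)

/-- For fixed `f` the integral is additive and norm continuous in the measure, so the series can be
integrated term by term. -/
lemma mkNorm_markovOp_le {R : ℕ → X →L[𝕜] X} {ω : ℕ → T → T} (hω : ∀ i, IsLip (ω i))
    (hR : Summable fun i => ‖R i‖) (hd : Summable fun i => ‖R i‖ * (1 + lipConst (ω i)))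
    (μ : cabv 𝕜 T X) :
    mkNorm (markovOp R ω μ) ≤ (∑' i, ‖R i‖ * (1 + lipConst (ω i))) * mkNorm μ := by
  refine mkNorm_le fun f hf => ?_
  have hsum := (hasSum_markovOp (fun i => (hω i).continuous.measurable) hR μ).map
    (vIntegralHom (𝕜 := 𝕜) hf.1.continuous) (continuous_vIntegral hf.1.continuous)
  exact hsum.norm_le_of_bounded (hd.hasSum.mul_right _)
    fun i => norm_vIntegral_pushforward_le (R i) (hω i) hf μ

end MK

/-! ### Weak* closedness of the balls. -/

section Ball

/-- The radial retraction onto the closed unit ball. -/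
noncomputable def ballRetract {X : Type*} [NormedAddCommGroup X] [NormedSpace ℝ X] (x : X) : X :=
  (max 1 ‖x‖)⁻¹ • x

section Retract

variable {X : Type*} [NormedAddCommGroup X] [NormedSpace ℝ X]

lemma continuous_ballRetract : Continuous (ballRetract : X → X) :=
  ((continuous_const.max continuous_norm).inv₀ fun _ => by positivity).smul continuous_id

lemma norm_ballRetract_le (x : X) : ‖ballRetract x‖ ≤ 1 := by
  have h : 0 < max 1 ‖x‖ := by positivity
  rw [ballRetract, norm_smul, norm_inv, Real.norm_of_nonneg h.le, inv_mul_le_iff₀ h, mul_one]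
  exact le_max_right _ _

/-- Outside the ball, `x` moves by `‖x‖ - 1 ≤ ‖x‖ - ‖y‖ ≤ ‖y - x‖`; the triangle inequality adds a
second `‖y - x‖`. -/
lemma norm_sub_ballRetract_le {y : X} (hy : ‖y‖ ≤ 1) (x : X) :
    ‖y - ballRetract x‖ ≤ 2 * ‖y - x‖ := by
  have key : ‖x - ballRetract x‖ ≤ ‖y - x‖ := by
    rcases le_total ‖x‖ 1 with hx | hx
    · simp [ballRetract, max_eq_left hx]
    · have hpos : 0 < ‖x‖ := one_pos.trans_le hx
      have h1 : x - ballRetract x = (1 - ‖x‖⁻¹) • x := by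
        rw [ballRetract, max_eq_right hx, sub_smul, one_smul]
      rw [h1, norm_smul, Real.norm_of_nonneg (sub_nonneg.2 (inv_le_one_of_one_le₀ hx)), sub_mul,
        inv_mul_cancel₀ hpos.ne', one_mul]
      have := norm_sub_norm_le x y
      rw [norm_sub_rev] at this
      linarith
  calc ‖y - ballRetract x‖ = ‖(y - x) + (x - ballRetract x)‖ := by rw [sub_add_sub_cancel]
    _ ≤ ‖y - x‖ + ‖x - ballRetract x‖ := norm_add_le _ _
    _ ≤ 2 * ‖y - x‖ := by linarith

end Retract

variable {𝕜 : Type*} [RCLike 𝕜] {T : Type*} [MeasurableSpace T]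
  {X : Type*} [NormedAddCommGroup X] [InnerProductSpace 𝕜 X] [NormedSpace ℝ X]
  [IsScalarTower ℝ 𝕜 X]

lemma exists_simple_vIntegral_eq (μ : cabv 𝕜 T X) (P : Finset (Set T))
    (hd : (P : Set (Set T)).PairwiseDisjoint id) (hP : ∀ t ∈ P, MeasurableSet t) :
    ∃ g : T → X, (∀ t, ‖g t‖ ≤ 1) ∧ Integrable g (μ : VectorMeasure T X).variation ∧
      vIntegral g μ = ((∑ p ∈ P, ‖(μ : VectorMeasure T X) p‖ : ℝ) : 𝕜) := by
  classical
  -- The direction of `μ p`, so that pairing with `μ p` gives `‖μ p‖`. If `μ p = 0`, the convention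
  -- `0⁻¹ = 0` gives the zero vector.
  set x : Set T → X := fun p => ((‖(μ : VectorMeasure T X) p‖⁻¹ : ℝ) : 𝕜) •
    (μ : VectorMeasure T X) p with hx
  have hxn (p : Set T) : ‖x p‖ ≤ 1 := by
    rw [hx, norm_smul, RCLike.norm_ofReal, abs_of_nonneg (by positivity)]
    exact inv_mul_le_one
  have hint (p : Set T) (hp : p ∈ P) :
      Integrable (p.indicator fun _ => x p) (μ : VectorMeasure T X).variation :=
    (integrable_const _).indicator (hP p hp)
  refine ⟨fun t => ∑ p ∈ P, p.indicator (fun _ => x p) t, fun t => ?_,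
    integrable_finsetSum _ hint, ?_⟩
  · beta_reduce
    by_cases ht : ∃ p ∈ P, t ∈ p
    · obtain ⟨p, hp, htp⟩ := ht
      have hq0 (q : Set T) (hq : q ∈ P) (hqp : q ≠ p) : q.indicator (fun _ => x q) t = 0 :=
        Set.indicator_of_notMem (fun htq => Set.disjoint_left.1 (hd hq hp hqp) htq htp) _
      rw [Finset.sum_eq_single_of_mem p hp hq0, Set.indicator_of_mem htp]
      exact hxn p
    · push Not at ht
      rw [Finset.sum_eq_zero fun q hq => Set.indicator_of_notMem (ht q hq) _, norm_zero]
      exact zero_le_one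
  · have h := VectorMeasure.integral_finsetSum (μ := (μ : VectorMeasure T X))
      (B := scalarProd 𝕜 X) P hint
    refine h.trans ?_
    rw [RCLike.ofReal_sum]
    refine Finset.sum_congr rfl fun p hp => ?_
    refine (vIntegral_indicator_const (hP p hp) (x p) μ).trans ?_
    rw [hx, inner_smul_right, inner_self_eq_norm_sq_to_K]
    rcases eq_or_ne (‖(μ : VectorMeasure T X) p‖) 0 with h0 | h0
    · simp [h0]
    · norm_cast
      rw [sq, inv_mul_cancel_left₀ h0]

variable [MetricSpace T] [CompactSpace T] [BorelSpace T]

/-- A finite partition nearly attains the variation, and its sum is the integral of a simple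
function bounded by `1`. An `L¹`-close continuous function, retracted to the unit ball, replaces the
simple one. -/
lemma norm_le_of_forall_vIntegral_le {μ : cabv 𝕜 T X} {a : ℝ}
    (h : ∀ f : T → X, Continuous f → (∀ t, ‖f t‖ ≤ 1) → ‖vIntegral f μ‖ ≤ a) : ‖μ‖ ≤ a := by
  refine le_of_forall_pos_le_add fun ε hε => ?_
  -- One `ε / 3` is spent on the partition and two on the approximation, because the retraction
  -- doubles the error.
  obtain ⟨P, -, hd, hP, hle⟩ := VectorMeasure.exists_variation_le_add
    (μ : VectorMeasure T X) MeasurableSet.univ (ε := (ε / 3).toNNReal)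
    (Real.toNNReal_pos.2 (by positivity)) (measure_ne_top _ _)
  have hsum : ‖μ‖ ≤ ∑ p ∈ P, ‖(μ : VectorMeasure T X) p‖ + ε / 3 := by
    rw [norm_cabv, measureReal_def]
    have hs : 0 ≤ ∑ p ∈ P, ‖(μ : VectorMeasure T X) p‖ := Finset.sum_nonneg fun _ _ => norm_nonneg _
    refine ENNReal.toReal_le_of_le_ofReal (by positivity) (hle.trans ?_)
    rw [ENNReal.ofReal_add hs (by positivity), ENNReal.ofReal_sum_of_nonneg fun _ _ => norm_nonneg _]
    simp_rw [ofReal_norm]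
    rfl
  obtain ⟨g, hg1, hgi, hg⟩ := exists_simple_vIntegral_eq μ P hd hP
  obtain ⟨k, hk, hki⟩ := hgi.exists_boundedContinuous_integral_sub_le (ε := ε / 3) (by positivity)
  have hc : Continuous fun t => ballRetract (k t) := continuous_ballRetract.comp k.continuous
  have hci := integrable_of_continuous hc (μ : VectorMeasure T X).variation
  have hf := h (fun t => ballRetract (k t)) hc fun t => norm_ballRetract_le _
  have hdiff : ‖vIntegral g μ - vIntegral (fun t => ballRetract (k t)) μ‖ ≤ 2 * (ε / 3) := by
    have hs : vIntegral (fun t => g t - ballRetract (k t)) μ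
        = vIntegral g μ - vIntegral (fun t => ballRetract (k t)) μ :=
      VectorMeasure.integral_fun_sub hgi hci
    rw [← hs]
    refine (norm_vIntegral_le_integral _ μ).trans ?_
    refine (integral_mono (hgi.sub hci).norm ((hgi.sub hki).norm.const_mul 2)
      fun t => norm_sub_ballRetract_le (hg1 t) (k t)).trans ?_
    rw [integral_const_mul]
    gcongr
    exact hk
  have hgn : ‖vIntegral g μ‖ = ∑ p ∈ P, ‖(μ : VectorMeasure T X) p‖ := by
    rw [hg, RCLike.norm_ofReal, abs_of_nonneg (Finset.sum_nonneg fun _ _ => norm_nonneg _)]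
  have htri := norm_sub_norm_le (vIntegral g μ) (vIntegral (fun t => ballRetract (k t)) μ)
  linarith

lemma isWeakStarClosed_cabvBall (a : ℝ) : IsWeakStarClosed (cabvBall 𝕜 T X a) := by
  have heq : cabvBall 𝕜 T X a = (fun μ (f : C(T, X)) => vIntegral (⇑f) μ) ⁻¹'
      (⋂ f ∈ {f : C(T, X) | ∀ t, ‖f t‖ ≤ 1}, {Λ : C(T, X) → 𝕜 | ‖Λ f‖ ≤ a}) := by
    ext μ
    simp only [Set.mem_preimage, Set.mem_iInter]
    refine ⟨fun hμ f hf => ?_, fun hμ => norm_le_of_forall_vIntegral_le fun f hf hf1 =>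
      hμ ⟨f, hf⟩ hf1⟩
    refine (norm_vIntegral_le hf zero_le_one μ).trans ?_
    rw [one_mul]
    exact hμ
  rw [heq]
  refine isClosed_induced_iff.2 ⟨_, ?_, rfl⟩
  exact isClosed_biInter fun f _ => isClosed_le (continuous_apply f).norm continuous_const

end Ball

/-! ### Contraction in total variation and the condition `d < 1`. -/

section FixedPoint

variable {𝕜 : Type*} [RCLike 𝕜] {T : Type*} [MeasurableSpace T]
  {X : Type*} [NormedAddCommGroup X] [NormedSpace 𝕜 X]

lemma contractingWith_markovOp_add [CompleteSpace X] {R : ℕ → X →L[𝕜] X} {ω : ℕ → T → T}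
    (hω : ∀ i, Measurable (ω i)) (hR : Summable fun i => ‖R i‖) (hlt : ∑' i, ‖R i‖ < 1)
    (μ₀ : cabv 𝕜 T X) :
    ContractingWith ⟨∑' i, ‖R i‖, tsum_nonneg fun _ => norm_nonneg _⟩
      fun μ => markovOp R ω μ + μ₀ := by
  refine ⟨by exact_mod_cast hlt, LipschitzWith.of_dist_le_mul fun μ ν => ?_⟩
  rw [dist_add_right, dist_eq_norm, dist_eq_norm, ← markovOp_sub hω hR]
  exact norm_markovOp_le hω hR _

lemma summable_norm_mul_one_add {R : ℕ → X →L[𝕜] X} {r : ℕ → ℝ} (hr0 : ∀ i, 0 ≤ r i)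
    (hr : BddAbove (Set.range r)) (hR : Summable fun i => ‖R i‖) :
    Summable fun i => ‖R i‖ * (1 + r i) := by
  obtain ⟨C, hC⟩ := hr
  refine Summable.of_nonneg_of_le (fun i => mul_nonneg (norm_nonneg _) (by linarith [hr0 i]))
    (fun i => ?_) (hR.mul_right (1 + C))
  have := hC ⟨i, rfl⟩
  gcongr

lemma tsum_norm_mul_one_add_lt_one {R : ℕ → X →L[𝕜] X} {r : ℕ → ℝ} (hr1 : ∀ i, r i < 1)
    (hR : Summable fun i => ‖R i‖) (hd : Summable fun i => ‖R i‖ * (1 + r i))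
    (hhalf : ∑' i, ‖R i‖ ≤ 1 / 2) : ∑' i, ‖R i‖ * (1 + r i) < 1 := by
  -- Termwise, `d ≤ 2 ∑ ‖Rᵢ‖ ≤ 1`; strictness needs an index with `Rⱼ ≠ 0`, and otherwise `d = 0`.
  by_cases h0 : ∀ i, ‖R i‖ = 0
  · simp [h0]
  push Not at h0
  obtain ⟨j, hj⟩ := h0
  have hjpos : 0 < ‖R j‖ := (norm_nonneg _).lt_of_ne' hj
  have hle : ∀ i, ‖R i‖ * (1 + r i) ≤ ‖R i‖ * 2 := fun i => by
    gcongr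
    linarith [hr1 i]
  have hlt : ‖R j‖ * (1 + r j) < ‖R j‖ * 2 := by
    gcongr
    linarith [hr1 j]
  calc ∑' i, ‖R i‖ * (1 + r i) < ∑' i, ‖R i‖ * 2 :=
        hd.tsum_lt_tsum hle hlt (hR.mul_right 2)
    _ = (∑' i, ‖R i‖) * 2 := tsum_mul_right
    _ ≤ 1 := by linarith

end FixedPoint

end VectorMarkov

theorem theorem3p2p2 {𝕜 : Type*} [RCLike 𝕜]
    {T : Type*} [MetricSpace T] [CompactSpace T] [Nontrivial T] [MeasurableSpace T] [BorelSpace T]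
    (n : ℕ) (hn : 1 ≤ n)
    (ω : ℕ → T → T) (hω : ∀ i, VectorMarkov.IsLip (ω i))
    (hr : BddAbove (Set.range fun i => VectorMarkov.lipConst (ω i)))
    (R : ℕ → EuclideanSpace 𝕜 (Fin n) →L[𝕜] EuclideanSpace 𝕜 (Fin n))
    (hR : Summable fun i => ‖R i‖) :
    -- the series defining `H` converges absolutely in `cabv(Kⁿ)`, with sum `H(μ)`
    (∀ μ : VectorMarkov.cabv 𝕜 T (EuclideanSpace 𝕜 (Fin n)),
      Summable (fun i => ‖VectorMarkov.pushforward (R i) (ω i) μ‖) ∧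
      HasSum (fun i => VectorMarkov.pushforward (R i) (ω i) μ) (VectorMarkov.markovOp R ω μ)) ∧
    -- the series `d` converges
    (Summable fun i => ‖R i‖ * (1 + VectorMarkov.lipConst (ω i))) ∧
    -- a particular case in which `d < 1`
    ((∀ i, VectorMarkov.lipConst (ω i) < 1) → ∑' i, ‖R i‖ ≤ 1 / 2 →
      ∑' i, ‖R i‖ * (1 + VectorMarkov.lipConst (ω i)) < 1) ∧
    -- a particular case in which `A = B_a(Kⁿ)` is admissible
    (∀ (a : ℝ) (μ₀ : VectorMarkov.cabv 𝕜 T (EuclideanSpace 𝕜 (Fin n))), 0 < a →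
      ‖μ₀‖ + a * ∑' i, ‖R i‖ ≤ a →
      (VectorMarkov.cabvBall 𝕜 T (EuclideanSpace 𝕜 (Fin n)) a).Nonempty ∧
      VectorMarkov.IsWeakStarClosed
        (VectorMarkov.cabvBall 𝕜 T (EuclideanSpace 𝕜 (Fin n)) a) ∧
      ∀ μ ∈ VectorMarkov.cabvBall 𝕜 T (EuclideanSpace 𝕜 (Fin n)) a,
        VectorMarkov.markovOp R ω μ + μ₀ ∈
          VectorMarkov.cabvBall 𝕜 T (EuclideanSpace 𝕜 (Fin n)) a) ∧
    -- the fixed point theorem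
    (∑' i, ‖R i‖ * (1 + VectorMarkov.lipConst (ω i)) < 1 →
      ∀ (a : ℝ) (μ₀ : VectorMarkov.cabv 𝕜 T (EuclideanSpace 𝕜 (Fin n)))
        (A : Set (VectorMarkov.cabv 𝕜 T (EuclideanSpace 𝕜 (Fin n)))), 0 < a →
      A.Nonempty → A ⊆ VectorMarkov.cabvBall 𝕜 T (EuclideanSpace 𝕜 (Fin n)) a →
      VectorMarkov.IsWeakStarClosed A →
      (∀ μ ∈ A, VectorMarkov.markovOp R ω μ + μ₀ ∈ A) →
      (∀ μ ∈ A, ∀ ν ∈ A,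
        VectorMarkov.mkDist (VectorMarkov.markovOp R ω μ + μ₀) (VectorMarkov.markovOp R ω ν + μ₀) ≤
          (∑' i, ‖R i‖ * (1 + VectorMarkov.lipConst (ω i))) * VectorMarkov.mkDist μ ν) ∧
      (μ₀ = 0 → 0 ∈ A) ∧
      ∃ μs ∈ A, VectorMarkov.markovOp R ω μs + μ₀ = μs ∧
        (∀ ν ∈ A, VectorMarkov.markovOp R ω ν + μ₀ = ν → ν = μs) ∧
        (μ₀ = 0 → μs = 0)) := by
  have hm : ∀ i, Measurable (ω i) := fun i => (hω i).continuous.measurable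
  have hr0 : ∀ i, 0 ≤ VectorMarkov.lipConst (ω i) := fun i => VectorMarkov.lipConst_nonneg _
  have hd := VectorMarkov.summable_norm_mul_one_add hr0 hr hR
  refine ⟨fun μ => ⟨VectorMarkov.summable_norm_pushforward hm hR μ,
    VectorMarkov.hasSum_markovOp hm hR μ⟩, hd,
    fun hr1 hhalf => VectorMarkov.tsum_norm_mul_one_add_lt_one hr1 hR hd hhalf,
    fun a μ₀ ha hμ₀ => ⟨⟨0, norm_zero.trans_le ha.le⟩,
      VectorMarkov.isWeakStarClosed_cabvBall a, fun μ hμ => ?_⟩,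
    fun hd1 a μ₀ A _ hne _ hA hinv => ?_⟩
  · have hμ' : ‖μ‖ ≤ a := hμ
    have h₁ : (∑' i, ‖R i‖) * ‖μ‖ ≤ (∑' i, ‖R i‖) * a :=
      mul_le_mul_of_nonneg_left hμ' (tsum_nonneg fun _ => norm_nonneg _)
    have h₂ := VectorMarkov.norm_markovOp_le hm hR μ
    have h₃ := norm_add_le (VectorMarkov.markovOp R ω μ) μ₀
    change ‖VectorMarkov.markovOp R ω μ + μ₀‖ ≤ a
    linarith
  -- `∑ ‖Rᵢ‖ ≤ d` since `1 ≤ 1 + rᵢ`: the hypothesis for `d_MK` also gives a contraction in total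
  -- variation.
  · have hlt : ∑' i, ‖R i‖ < 1 :=
      (hR.tsum_le_tsum (fun i => le_mul_of_one_le_right (norm_nonneg _)
        (le_add_of_nonneg_right (hr0 i))) hd).trans_lt hd1
    have hcontr := VectorMarkov.contractingWith_markovOp_add hm hR hlt μ₀
    obtain ⟨μ, hμ⟩ := hne
    have hmaps : Set.MapsTo (fun μ => VectorMarkov.markovOp R ω μ + μ₀) A A := hinv
    obtain ⟨μs, hμs, hfix, -⟩ := ContractingWith.exists_fixedPoint' hA.isClosed.isComplete hmaps
      (hcontr.restrict hmaps) hμ (edist_ne_top _ _)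
    -- When `μ₀ = 0`, `0` is fixed in the whole space, where fixed points are unique; membership of
    -- `0` in `A` is deduced from this.
    have hzero : μ₀ = 0 → μs = 0 := fun h0 => by
      refine hcontr.fixedPoint_unique' hfix ?_
      have h := VectorMarkov.norm_markovOp_le hm hR
        (0 : VectorMarkov.cabv 𝕜 T (EuclideanSpace 𝕜 (Fin n)))
      rw [norm_zero, mul_zero, norm_le_zero_iff] at h
      change VectorMarkov.markovOp R ω 0 + μ₀ = 0
      rw [h, h0, add_zero]
    refine ⟨fun μ _ ν _ => ?_, fun h0 => hzero h0 ▸ hμs, μs, hμs, hfix,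
      fun ν _ hν => hcontr.fixedPoint_unique' hν hfix, hzero⟩
    rw [VectorMarkov.mkDist, VectorMarkov.mkDist, add_sub_add_right_eq_sub,
      ← VectorMarkov.markovOp_sub hm hR]
    exact VectorMarkov.mkNorm_markovOp_le hω hR hd _
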